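/- Let $\mathbb{H}$ be the upper half plane. For $\tau\in\mathbb{H}$ put $q=\exp(2\pi i\tau)$, and let $\eta(\tau)=e^{2\pi i\tau/24}\prod_{n=1}^{\infty}(1-q^n)$ be the Dedekind eta function. For every $\tau\in\mathbb{H}$, $$\frac{\eta^2(\tau)\,\eta(2\tau)\,\eta^3(4\tau)}{\eta^2(8\tau)} = 1-2\sum_{n=1}^{\infty}\left(\sum_{d\mid n} d\left(\frac{8}{d}\right)\right)q^n,$$ where the series converges absolutely, $d$ runs over the positive divisors of $n$, and for each positive integer $m$ the symbol $\left(\frac{8}{m}\right)$ is $+1$ if $m\equiv\pm1\pmod 8$, $-1$ if $m\equiv\pm3\pmod 8$, and $0$ if $m$ is even. -/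

import Mathlib

/-- The Kronecker symbol `(8 / m)`: `1` if `m ≡ ±1 (mod 8)`, `-1` if `m ≡ ±3 (mod 8)`,
`0` if `m` is even. -/
def kronecker8 (m : ℕ) : ℤ :=
  if m % 8 = 1 ∨ m % 8 = 7 then 1 else if m % 8 = 3 ∨ m % 8 = 5 then -1 else 0

/-- The symbol is the primitive quadratic character `χ₈` modulo `8`. -/
theorem kronecker8_eq_χ₈ (m : ℕ) : kronecker8 m = ZMod.χ₈ (m : ZMod 8) := by
  rw [ZMod.χ₈_nat_eq_if_mod_eight, kronecker8]
  have h : m % 8 < 8 := Nat.mod_lt _ (by norm_num)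
  grind

/-! The identity is the addition formula `℘(u) - ℘(v) = -σ(u+v)σ(u-v)/(σ(u)²σ(v)²)`, in the
multiplicative coordinate `x` on `ℂˣ/qᶻ`, evaluated at `x = ζ`, `y = ζ ^ 3` with `ζ` a primitive
eighth root of unity. On the ℘ side the Lambert coefficients combine into `ζᵈ + ζ⁻ᵈ - ζ³ᵈ - ζ⁻³ᵈ`, a
Gauss sum proportional to `(8/d)` (`kronecker8_gauss_sum`), so the difference is a multiple of the
divisor series. On the theta side, products at `±x` multiply to a product in `q²` at `x²`, and
everything collapses to eta products (`qProd_quotient_eq_one_sub_tsum`). The addition formula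
(`weierstrass_sub_weierstrass_eq_qTheta`) is a Liouville argument: the two sides have the same
double pole at `x = 1` and are invariant under `x ↦ q x`, so they differ by a constant, which is
read off at `x = y`. -/

open Complex Filter Topology

/-! ### Liouville's theorem on an annulus -/

/-- The open annulus `‖q‖ < ‖x‖ < ‖q‖⁻¹`. -/
def nomeAnnulus (q : ℂ) : Set ℂ := {x | ‖q‖ < ‖x‖ ∧ ‖x‖ < ‖q‖⁻¹}

theorem isOpen_nomeAnnulus (q : ℂ) : IsOpen (nomeAnnulus q) :=
  (isOpen_lt continuous_const continuous_norm).inter (isOpen_lt continuous_norm continuous_const)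

/-- The exponential maps a convex vertical strip onto the annulus. -/
theorem isPreconnected_nomeAnnulus {q : ℂ} (hq : 0 < ‖q‖) : IsPreconnected (nomeAnnulus q) := by
  have hstrip : IsPreconnected {z : ℂ | Real.log ‖q‖ < z.re ∧ z.re < Real.log ‖q‖⁻¹} :=
    ((convex_halfSpace_re_gt _).inter (convex_halfSpace_re_lt _)).isPreconnected
  convert! hstrip.image Complex.exp Complex.continuous_exp.continuousOn
  ext x
  constructor
  · rintro ⟨h1, h2⟩
    have hx : 0 < ‖x‖ := hq.trans h1
    refine ⟨Complex.log x, ⟨?_, ?_⟩, Complex.exp_log (norm_pos_iff.1 hx)⟩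
    · rw [Complex.log_re]; exact Real.log_lt_log hq h1
    · rw [Complex.log_re]; exact Real.log_lt_log hx h2
  · rintro ⟨z, ⟨h1, h2⟩, rfl⟩
    refine ⟨?_, ?_⟩
    · rw [Complex.norm_exp]; exact (Real.log_lt_iff_lt_exp hq).1 h1
    · rw [Complex.norm_exp]; exact (Real.lt_log_iff_exp_lt (inv_pos.2 hq)).1 h2

theorem ne_zero_of_mem_nomeAnnulus {q x : ℂ} (hx : x ∈ nomeAnnulus q) : x ≠ 0 :=
  norm_pos_iff.1 ((norm_nonneg q).trans_lt hx.1)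

theorem norm_mul_lt_one_of_mem_nomeAnnulus {q x : ℂ} (hq : 0 < ‖q‖) (hx : x ∈ nomeAnnulus q) :
    ‖q * x‖ < 1 := by
  rw [norm_mul]
  calc _ < ‖q‖ * ‖q‖⁻¹ := by gcongr; exact hx.2
    _ = 1 := mul_inv_cancel₀ hq.ne'

theorem inv_mem_nomeAnnulus {q x : ℂ} (hq : 0 < ‖q‖) (hx : x ∈ nomeAnnulus q) :
    x⁻¹ ∈ nomeAnnulus q := by
  have h0 : 0 < ‖x‖ := hq.trans hx.1
  refine ⟨?_, ?_⟩
  · rw [norm_inv]; exact (lt_inv_comm₀ h0 hq).1 hx.2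
  · rw [norm_inv]; exact (inv_lt_inv₀ h0 hq).2 hx.1

theorem mem_nomeAnnulus_of_norm_eq_one {q x : ℂ} (hq : 0 < ‖q‖) (hq1 : ‖q‖ < 1) (hx : ‖x‖ = 1) :
    x ∈ nomeAnnulus q :=
  ⟨hx ▸ hq1, hx ▸ (one_lt_inv₀ hq).2 hq1⟩

/-- A holomorphic function on the annulus that is invariant under `x ↦ q x` is constant. -/
theorem eq_of_differentiableOn_nomeAnnulus_of_periodic {q : ℂ} (hq : 0 < ‖q‖) (hq1 : ‖q‖ < 1)
    {g : ℂ → ℂ} (hg : DifferentiableOn ℂ g (nomeAnnulus q))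
    (hper : ∀ x, 1 < ‖x‖ → ‖x‖ < ‖q‖⁻¹ → g (q * x) = g x) {x y : ℂ}
    (hx : x ∈ nomeAnnulus q) (hy : y ∈ nomeAnnulus q) : g x = g y := by
  -- `A` is a compact fundamental domain for `x ↦ q x` inside the open annulus. Periodicity moves
  -- every point of the annulus into `A`, so the maximum of `‖g‖` on `A` is a maximum on the whole
  -- annulus, at an interior point.
  set A : Set ℂ := {x | √‖q‖ ≤ ‖x‖ ∧ ‖x‖ ≤ (√‖q‖)⁻¹}
  have hs0 : 0 < √‖q‖ := Real.sqrt_pos.2 hq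
  have hss : √‖q‖ * √‖q‖ = ‖q‖ := Real.mul_self_sqrt hq.le
  have hs1 : √‖q‖ < 1 := by nlinarith
  have hqs : ‖q‖ < √‖q‖ := by nlinarith
  have hqs' : (√‖q‖)⁻¹ < ‖q‖⁻¹ := (inv_lt_inv₀ hs0 hq).2 hqs
  have hAc : IsCompact A := by
    refine Metric.isCompact_of_isClosed_isBounded ?_ ?_
    · exact (isClosed_le continuous_const continuous_norm).inter
        (isClosed_le continuous_norm continuous_const)
    · exact isBounded_iff_forall_norm_le.2 ⟨_, fun x hx => hx.2⟩
  have hAU : A ⊆ nomeAnnulus q := fun x hx => ⟨hqs.trans_le hx.1, hx.2.trans_lt hqs'⟩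
  have h1A : (1 : ℂ) ∈ A := by
    refine ⟨by simpa using hs1.le, ?_⟩
    simpa using (one_le_inv₀ hs0).2 hs1.le
  obtain ⟨c, hcA, hc⟩ := hAc.exists_isMaxOn ⟨1, h1A⟩ (hg.continuousOn.mono hAU).norm
  have hinv : (√‖q‖)⁻¹ = √‖q‖ * ‖q‖⁻¹ := by
    rw [eq_mul_inv_iff_mul_eq₀ hq.ne', inv_mul_eq_iff_eq_mul₀ hs0.ne', hss]
  have hmax : IsMaxOn (norm ∘ g) (nomeAnnulus q) c := by
    intro x hx
    change ‖g x‖ ≤ ‖g c‖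
    by_cases h1 : √‖q‖ ≤ ‖x‖
    · by_cases h2 : ‖x‖ ≤ (√‖q‖)⁻¹
      · exact hc ⟨h1, h2⟩
      · push Not at h2
        have h3 : 1 < ‖x‖ := ((one_lt_inv₀ hs0).2 hs1).trans h2
        rw [← hper x h3 hx.2]
        refine hc ⟨?_, ?_⟩
        · rw [norm_mul]
          rw [hinv] at h2
          calc √‖q‖ = ‖q‖ * (√‖q‖ * ‖q‖⁻¹) := by field_simp
            _ ≤ _ := by gcongr
        · refine (norm_mul_lt_one_of_mem_nomeAnnulus hq hx).le.trans ((one_le_inv₀ hs0).2 hs1.le)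
    · push Not at h1
      have hx0 := ne_zero_of_mem_nomeAnnulus hx
      have hq0 := norm_pos_iff.1 hq
      have h2 : 1 < ‖x / q‖ := by rw [norm_div]; exact (one_lt_div hq).2 hx.1
      have h3 : ‖x / q‖ < (√‖q‖)⁻¹ := by
        rw [norm_div, hinv, div_eq_mul_inv]
        gcongr
      have := hper (x / q) h2 (h3.trans hqs')
      rw [mul_div_cancel₀ _ hq0] at this
      rw [this]
      exact hc ⟨hs1.le.trans h2.le, h3.le⟩
  have := Complex.eqOn_of_isPreconnected_of_isMaxOn_norm (isPreconnected_nomeAnnulus hq)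
    (isOpen_nomeAnnulus q) hg (hAU hcA) hmax
  exact (this hx).trans (this hy).symm

/-! ### The infinite product -/

/-- The product `∏_{n ≥ 1} (1 - qⁿ x)`. -/
noncomputable def qProd (q x : ℂ) : ℂ := ∏' n : ℕ, (1 - q ^ (n + 1) * x)

theorem summable_norm_qProd {q : ℂ} (hq1 : ‖q‖ < 1) (x : ℂ) :
    Summable fun n : ℕ => ‖-(q ^ (n + 1) * x)‖ := by
  have := ((summable_nat_add_iff 1).2 (summable_geometric_of_lt_one (norm_nonneg q) hq1)).mul_right
    ‖x‖
  simpa using this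

theorem multipliable_qProd {q : ℂ} (hq1 : ‖q‖ < 1) (x : ℂ) :
    Multipliable fun n : ℕ => 1 - q ^ (n + 1) * x := by
  simpa [sub_eq_add_neg] using multipliable_one_add_of_summable (summable_norm_qProd hq1 x)

theorem qProd_eq {q : ℂ} (hq1 : ‖q‖ < 1) (x : ℂ) : qProd q x = (1 - q * x) * qProd q (q * x) := by
  have h := multipliable_qProd hq1 (q * x)
  have := tprod_eq_zero_mul' (f := fun n : ℕ => 1 - q ^ (n + 1) * x)
    (h.congr fun n => by ring)
  rw [qProd, qProd, this]
  congr 1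
  · simp
  · exact tprod_congr fun n => by ring

theorem qProd_ne_zero {q x : ℂ} (hq1 : ‖q‖ < 1) (hx : ‖q * x‖ < 1) : qProd q x ≠ 0 := by
  have := tprod_one_add_ne_zero_of_summable (f := fun n : ℕ => -(q ^ (n + 1) * x)) ?_
    (summable_norm_qProd hq1 x)
  · simpa [qProd, sub_eq_add_neg] using this
  · intro n h
    have h1 : q ^ (n + 1) * x = 1 := by linear_combination -h
    have h2 : ‖q ^ (n + 1) * x‖ < 1 := by
      rw [pow_succ, mul_assoc, norm_mul, norm_pow]
      exact mul_lt_one_of_nonneg_of_lt_one_right (pow_le_one₀ (norm_nonneg _) hq1.le)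
        (norm_nonneg _) hx
    simp [h1] at h2

theorem differentiable_qProd {q : ℂ} (hq1 : ‖q‖ < 1) : Differentiable ℂ (qProd q) := by
  have key : HasProdLocallyUniformlyOn (fun (n : ℕ) (x : ℂ) => 1 + -(q ^ (n + 1) * x))
      (fun x => ∏' n : ℕ, (1 + -(q ^ (n + 1) * x))) Set.univ := by
    apply hasProdLocallyUniformlyOn_of_forall_compact isOpen_univ
    intro K _ hcK
    obtain ⟨R, hR⟩ := hcK.isBounded.exists_norm_le
    refine (((summable_nat_add_iff 1).2
      (summable_geometric_of_lt_one (norm_nonneg q) hq1)).mul_right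
        R).hasProdUniformlyOn_nat_one_add hcK (.of_forall fun n x hx => ?_) (fun _ => by fun_prop)
    rw [norm_neg, norm_mul, norm_pow]
    gcongr
    exact hR x hx
  have := key.differentiableOn
    (.of_forall fun _ => by simpa [Finset.prod_fn] using
      DifferentiableOn.finsetProd (fun _ _ => by fun_prop)) isOpen_univ
  have h2 : qProd q = fun x => ∏' n : ℕ, (1 + -(q ^ (n + 1) * x)) := by
    ext x; simp [qProd, sub_eq_add_neg]
  rw [h2]
  exact differentiableOn_univ.1 this

/-- The factors pair as a difference of squares. Iterated at eighth roots of unity, this reduces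
every product to values at `1`. -/
theorem qProd_mul_qProd_neg {q : ℂ} (hq1 : ‖q‖ < 1) (x : ℂ) :
    qProd q x * qProd q (-x) = qProd (q ^ 2) (x ^ 2) := by
  rw [qProd, qProd, ← (multipliable_qProd hq1 x).tprod_mul (multipliable_qProd hq1 (-x))]
  exact tprod_congr fun n => by ring

/-! ### The Lambert series -/

/-- The Lambert series `∑ d qᵈ / (1 - qᵈ) xᵈ`. -/
noncomputable def lambertSeries (q x : ℂ) : ℂ := ∑' d : ℕ, d * q ^ d / (1 - q ^ d) * x ^ d

theorem norm_lambertSeries_term_le {q : ℂ} (hq1 : ‖q‖ < 1) (x : ℂ) (d : ℕ) :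
    ‖d * q ^ d / (1 - q ^ d) * x ^ d‖ ≤ (1 - ‖q‖)⁻¹ * (d ^ 1 * ‖q * x‖ ^ d) := by
  -- The term at `d = 0` is `0 / 0`, which is `0` by convention.
  rcases Nat.eq_zero_or_pos d with rfl | hd
  · simp
  have h1 : 1 - ‖q‖ ≤ ‖1 - q ^ d‖ := by
    have := norm_sub_norm_le (1 : ℂ) (q ^ d)
    have h2 : ‖q ^ d‖ ≤ ‖q‖ := by
      rw [norm_pow]; exact pow_le_of_le_one (norm_nonneg _) hq1.le hd.ne'
    simp only [norm_one] at this
    linarith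
  have h3 : 0 < 1 - ‖q‖ := by linarith
  rw [norm_mul, norm_div, norm_mul, norm_mul, norm_pow, norm_pow, Complex.norm_natCast, mul_pow,
    div_eq_inv_mul, pow_one]
  calc _ = ‖1 - q ^ d‖⁻¹ * (d * (‖q‖ ^ d * ‖x‖ ^ d)) := by ring
    _ ≤ _ := by gcongr

theorem summable_lambertSeries {q x : ℂ} (hq1 : ‖q‖ < 1) (hx : ‖q * x‖ < 1) :
    Summable fun d : ℕ => d * q ^ d / (1 - q ^ d) * x ^ d :=
  have h : Summable fun d : ℕ => (d : ℝ) ^ 1 * ‖q * x‖ ^ d :=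
    summable_pow_mul_geometric_of_norm_lt_one 1 (by rwa [norm_norm])
  Summable.of_norm_bounded (h.mul_left _) (norm_lambertSeries_term_le hq1 x)

/-- Termwise, `xᵈ - (q x)ᵈ` cancels the denominator `1 - qᵈ`, leaving `∑ d (q x)ᵈ`. -/
theorem lambertSeries_sub {q x : ℂ} (hq1 : ‖q‖ < 1) (hx : ‖q * x‖ < 1) :
    lambertSeries q x - lambertSeries q (q * x) = q * x / (1 - q * x) ^ 2 := by
  have hx' : ‖q * (q * x)‖ < 1 := by
    rw [norm_mul]; exact mul_lt_one_of_nonneg_of_lt_one_left (norm_nonneg _) hq1 hx.le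
  rw [lambertSeries, lambertSeries, ← (summable_lambertSeries hq1 hx).tsum_sub
    (summable_lambertSeries hq1 hx'), ← tsum_coe_mul_geometric_of_norm_lt_one hx]
  refine tsum_congr fun d => ?_
  rcases Nat.eq_zero_or_pos d with rfl | hd
  · simp
  have h2 : 1 - q ^ d ≠ 0 := by
    intro h
    have h1 : q ^ d = 1 := by linear_combination -h
    have := pow_lt_one₀ (norm_nonneg q) hq1 hd.ne'
    rw [← norm_pow, h1] at this
    simp at this
  rw [mul_pow]
  field_simp

theorem differentiableOn_lambertSeries {q : ℂ} (hq1 : ‖q‖ < 1) :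
    DifferentiableOn ℂ (lambertSeries q) {x | ‖q * x‖ < 1} := by
  intro x hx
  obtain ⟨r, hr1, hr2⟩ := exists_between (show ‖q * x‖ < 1 from hx)
  have hr0 : 0 ≤ r := (norm_nonneg _).trans hr1.le
  have ho : IsOpen {x : ℂ | ‖q * x‖ < r} := isOpen_lt (by fun_prop) continuous_const
  have hs : Summable fun d : ℕ => (d : ℝ) ^ 1 * r ^ d :=
    summable_pow_mul_geometric_of_norm_lt_one 1 (by rwa [Real.norm_of_nonneg hr0])
  have := differentiableOn_tsum_of_summable_norm (U := {x : ℂ | ‖q * x‖ < r})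
    (F := fun (d : ℕ) (x : ℂ) => d * q ^ d / (1 - q ^ d) * x ^ d) (hs.mul_left (1 - ‖q‖)⁻¹)
    (fun d => by fun_prop) ho (fun d x hx => (norm_lambertSeries_term_le hq1 x d).trans ?_)
  · exact ((this x hr1).differentiableAt (ho.mem_nhds hr1)).differentiableWithinAt
  · have h3 : 0 < 1 - ‖q‖ := by linarith
    have : ‖q * x‖ ≤ r := le_of_lt hx
    gcongr

/-! ### The theta function -/

/-- The theta function `(1 - x) ∏_{n ≥ 1} (1 - qⁿ x) (1 - qⁿ x⁻¹)`. -/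
noncomputable def qTheta (q x : ℂ) : ℂ := (1 - x) * (qProd q x * qProd q x⁻¹)

theorem qTheta_one (q : ℂ) : qTheta q 1 = 0 := by simp [qTheta]

theorem qTheta_inv {x : ℂ} (q : ℂ) (hx : x ≠ 0) : qTheta q x⁻¹ = -x⁻¹ * qTheta q x := by
  simp only [qTheta, inv_inv]
  field_simp
  ring

theorem qTheta_mul {q x : ℂ} (hq0 : q ≠ 0) (hq1 : ‖q‖ < 1) (hx : x ≠ 0) :
    qTheta q (q * x) = -x⁻¹ * qTheta q x := by
  have h1 := qProd_eq hq1 x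
  have h2 := qProd_eq hq1 (q * x)⁻¹
  have h3 : q * (q * x)⁻¹ = x⁻¹ := by field_simp
  rw [h3] at h2
  rw [qTheta, qTheta, h1, h2]
  field_simp
  ring

theorem qProd_mul_qProd_inv_ne_zero {q x : ℂ} (hq : 0 < ‖q‖) (hq1 : ‖q‖ < 1)
    (hx : x ∈ nomeAnnulus q) : qProd q x * qProd q x⁻¹ ≠ 0 :=
  mul_ne_zero (qProd_ne_zero hq1 (norm_mul_lt_one_of_mem_nomeAnnulus hq hx))
    (qProd_ne_zero hq1 (norm_mul_lt_one_of_mem_nomeAnnulus hq (inv_mem_nomeAnnulus hq hx)))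

theorem qTheta_ne_zero {q x : ℂ} (hq : 0 < ‖q‖) (hq1 : ‖q‖ < 1)
    (hx : x ∈ nomeAnnulus q) (hx1 : x ≠ 1) : qTheta q x ≠ 0 :=
  mul_ne_zero (sub_ne_zero.2 hx1.symm) (qProd_mul_qProd_inv_ne_zero hq hq1 hx)

theorem differentiableAt_qTheta {q x : ℂ} (hq1 : ‖q‖ < 1) (hx : x ≠ 0) :
    DifferentiableAt ℂ (qTheta q) x := by
  have h := differentiable_qProd hq1
  unfold qTheta
  have h2 : DifferentiableAt ℂ (fun x => qProd q x⁻¹) x :=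
    DifferentiableAt.fun_comp' x (h x⁻¹) (differentiableAt_inv hx)
  fun_prop

/-! ### The Weierstrass function and its addition formula -/

/-- The part of the Weierstrass function, in multiplicative coordinates, that has no poles in the
annulus. -/
noncomputable def lambertSym (q x : ℂ) : ℂ := lambertSeries q x + lambertSeries q x⁻¹

theorem differentiableOn_lambertSym {q : ℂ} (hq : 0 < ‖q‖) (hq1 : ‖q‖ < 1) :
    DifferentiableOn ℂ (lambertSym q) (nomeAnnulus q) := by
  refine DifferentiableOn.add ?_ ?_
  · exact (differentiableOn_lambertSeries hq1).mono
      fun x hx => norm_mul_lt_one_of_mem_nomeAnnulus hq hx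
  · refine (differentiableOn_lambertSeries hq1).fun_comp (g := lambertSeries q) ?_
      fun x hx => norm_mul_lt_one_of_mem_nomeAnnulus hq (inv_mem_nomeAnnulus hq hx)
    exact fun x hx => (differentiableAt_inv (ne_zero_of_mem_nomeAnnulus hx)).differentiableWithinAt

/-- The shift relation is used at `x` and at `(q x)⁻¹`; the rational terms match because `x / (1 -
x) ^ 2` is invariant under inversion. The bounds on `‖x‖` say that `x` and `q x` both lie in the
annulus. -/
theorem lambertSym_mul {q x : ℂ} (hq : 0 < ‖q‖) (hq1 : ‖q‖ < 1) (hx : 1 < ‖x‖)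
    (hx' : ‖x‖ < ‖q‖⁻¹) :
    q * x / (1 - q * x) ^ 2 + lambertSym q (q * x) = x / (1 - x) ^ 2 + lambertSym q x := by
  have hq0 := norm_pos_iff.1 hq
  have hx0 : x ≠ 0 := norm_pos_iff.1 (zero_lt_one.trans hx)
  have hxU : x ∈ nomeAnnulus q := ⟨hq1.trans hx, hx'⟩
  have h1 := lambertSeries_sub hq1 (norm_mul_lt_one_of_mem_nomeAnnulus hq hxU)
  have h3 : q * (q * x)⁻¹ = x⁻¹ := by field_simp
  have h2 := lambertSeries_sub (x := (q * x)⁻¹) hq1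
    (by rw [h3, norm_inv]; exact inv_lt_one_of_one_lt₀ hx)
  have h4 : x⁻¹ / (1 - x⁻¹) ^ 2 = x / (1 - x) ^ 2 := by
    have h5 : x - 1 ≠ 0 := by
      intro h
      rw [sub_eq_zero.1 h] at hx
      simp at hx
    have h6 : 1 - x ≠ 0 := fun h => h5 (by linear_combination -h)
    field_simp
    ring
  rw [h3, h4] at h2
  rw [lambertSym, lambertSym]
  linear_combination h2 - h1

/-- A holomorphic function with a double zero at `1`, divided by `(x - 1) ^ 2`. -/
theorem exists_differentiableOn_eq_sub_sq_mul {K : ℂ → ℂ} {s : Set ℂ} {c : ℂ} (hs : IsOpen s)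
    (hc : c ∈ s) (hK : DifferentiableOn ℂ K s) (h0 : K c = 0) (h1 : deriv K c = 0) :
    ∃ g, DifferentiableOn ℂ g s ∧ ∀ x, K x = (x - c) ^ 2 * g x := by
  refine ⟨dslope (dslope K c) c, ?_, fun x => ?_⟩
  · exact (Complex.differentiableOn_dslope (hs.mem_nhds hc)).2
      ((Complex.differentiableOn_dslope (hs.mem_nhds hc)).2 hK)
  · have h2 := sub_smul_dslope K c x
    have h3 := sub_smul_dslope (dslope K c) c x
    rw [dslope_same, h1] at h3
    simp only [smul_eq_mul] at h2 h3
    rw [h0] at h2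
    linear_combination -h2 - (x - c) * h3

/-- Differentiating the symmetry at `1` gives `-K' = K' - 2 K`, and `K` vanishes there. This makes a
zero double without computing any derivative of theta. -/
theorem deriv_eq_zero_of_inv_symm {K : ℂ → ℂ} (hK : DifferentiableAt ℂ K 1) (h0 : K 1 = 0)
    (hinv : ∀ x, x ≠ 0 → K x⁻¹ = K x / x ^ 2) : deriv K 1 = 0 := by
  have h1 : HasDerivAt (fun x : ℂ => K x⁻¹) (deriv K 1 * -1) 1 := by
    have ha : HasDerivAt (fun x : ℂ => x⁻¹) (-1) 1 := by
      simpa using hasDerivAt_inv (one_ne_zero (α := ℂ))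
    exact HasDerivAt.comp (h := fun x : ℂ => x⁻¹) 1 (by simpa using hK.hasDerivAt) ha
  have h2 : HasDerivAt (fun x : ℂ => K x / x ^ 2) (deriv K 1) 1 := by
    have := hK.hasDerivAt.div ((hasDerivAt_id' (1 : ℂ)).pow 2) (by simp)
    simpa [h0] using! this
  have h3 : (fun x : ℂ => K x⁻¹) =ᶠ[𝓝 1] fun x => K x / x ^ 2 := by
    filter_upwards [isOpen_ne.mem_nhds (one_ne_zero (α := ℂ))] with x hx using hinv x hx
  have := (h2.congr_of_eventuallyEq h3).unique h1
  linear_combination this / 2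

/-- The difference of two values of the Weierstrass function as a quotient of theta functions. -/
theorem weierstrass_sub_weierstrass_eq_qTheta {q x y : ℂ} (hq : 0 < ‖q‖) (hq1 : ‖q‖ < 1)
    (hx : x ∈ nomeAnnulus q) (hx1 : x ≠ 1) (hy : y ∈ nomeAnnulus q) (hy1 : y ≠ 1) :
    x / (1 - x) ^ 2 + lambertSym q x - (y / (1 - y) ^ 2 + lambertSym q y) =
      -(y * qProd q 1 ^ 4 * (qTheta q (x * y) * qTheta q (x * y⁻¹))) /
        (qTheta q x ^ 2 * qTheta q y ^ 2) := by
  have hq0 := norm_pos_iff.1 hq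
  have hy0 := ne_zero_of_mem_nomeAnnulus hy
  have h1U : (1 : ℂ) ∈ nomeAnnulus q := mem_nomeAnnulus_of_norm_eq_one hq hq1 (by simp)
  have hθy := qTheta_ne_zero hq hq1 hy hy1
  have hE1 : qProd q 1 ≠ 0 := qProd_ne_zero hq1 (by simpa using hq1)
  -- Under `x ↦ q x`, both `D` and `qTheta q x ^ 2` acquire the factor `x⁻²`, so their quotient is
  -- invariant.
  set D : ℂ → ℂ := fun x => qTheta q (x * y) * qTheta q (x * y⁻¹) with hD
  -- `C` is chosen so that `C * D 1 = qProd q 1 ^ 4`, which matches the leading coefficients of the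
  -- two double poles at `1`.
  set C : ℂ := -(y * qProd q 1 ^ 4) / qTheta q y ^ 2 with hC
  have hDmul : ∀ x, x ≠ 0 → D (q * x) = D x * (x ^ 2)⁻¹ := fun x hx => by
    have h1 := qTheta_mul hq0 hq1 (mul_ne_zero hx hy0)
    have h2 := qTheta_mul hq0 hq1 (mul_ne_zero hx (inv_ne_zero hy0))
    simp only [hD, mul_assoc] at h1 h2 ⊢
    rw [h1, h2]
    field_simp
  have hDinv : ∀ x, x ≠ 0 → D x⁻¹ = D x / x ^ 2 := fun x hx => by
    have h1 := qTheta_inv q (mul_ne_zero hx hy0)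
    have h2 := qTheta_inv q (mul_ne_zero hx (inv_ne_zero hy0))
    rw [mul_inv] at h1 h2
    rw [inv_inv] at h2
    simp only [hD]
    rw [h1, h2]
    field_simp
  have hD1 : C * D 1 = qProd q 1 ^ 4 := by
    simp only [hD, hC, one_mul, qTheta_inv q hy0]
    field_simp
  have hDy : D y = 0 := by simp [hD, mul_inv_cancel₀ hy0, qTheta_one]
  have hDdiff : ∀ x, x ≠ 0 → DifferentiableAt ℂ D x := fun x hx => by
    refine DifferentiableAt.mul ?_ ?_
    · exact DifferentiableAt.fun_comp' x (f := fun x => x * y)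
        (differentiableAt_qTheta hq1 (mul_ne_zero hx hy0)) (by fun_prop)
    · exact DifferentiableAt.fun_comp' x (f := fun x => x * y⁻¹)
        (differentiableAt_qTheta hq1 (mul_ne_zero hx (inv_ne_zero hy0))) (by fun_prop)
  set P : ℂ → ℂ := fun x => qProd q x * qProd q x⁻¹ with hP
  have hPne : ∀ x ∈ nomeAnnulus q, P x ≠ 0 := fun x hx => qProd_mul_qProd_inv_ne_zero hq hq1 hx
  have hPdiff : ∀ x, x ≠ 0 → DifferentiableAt ℂ P x := fun x hx =>
    ((differentiable_qProd hq1) x).mul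
      (DifferentiableAt.fun_comp' x (differentiable_qProd hq1 x⁻¹) (differentiableAt_inv hx))
  -- `K` is `(1 - x) ^ 2` times the difference of `x / (1 - x) ^ 2` and `C * D x / qTheta q x ^ 2`;
  -- a double zero at `1` means that this difference has no pole.
  set K : ℂ → ℂ := fun x => x - C * D x / P x ^ 2 with hK
  have hKdiff : DifferentiableOn ℂ K (nomeAnnulus q) := fun x hx => by
    have hx0 := ne_zero_of_mem_nomeAnnulus hx
    exact (differentiableAt_id.sub (((hDdiff x hx0).const_mul C).div ((hPdiff x hx0).pow 2)
      (pow_ne_zero 2 (hPne x hx)))).differentiableWithinAt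
  have hK1 : K 1 = 0 := by
    simp only [hK, hD1, hP, inv_one]
    field_simp
    ring
  have hKinv : ∀ x, x ≠ 0 → K x⁻¹ = K x / x ^ 2 := fun x hx => by
    have h1 : P x⁻¹ = P x := by simp [hP, mul_comm]
    simp only [hK, h1, hDinv x hx]
    field_simp
  obtain ⟨g, hg, hgK⟩ := exists_differentiableOn_eq_sub_sq_mul (isOpen_nomeAnnulus q) h1U hKdiff hK1
    (deriv_eq_zero_of_inv_symm (hKdiff.differentiableAt ((isOpen_nomeAnnulus q).mem_nhds h1U))
      hK1 hKinv)
  have hgeq : ∀ x, x ∈ nomeAnnulus q → x ≠ 1 →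
      g x = x / (1 - x) ^ 2 - C * (D x / qTheta q x ^ 2) := fun x hx hx1 => by
    have h1 : 1 - x ≠ 0 := sub_ne_zero.2 hx1.symm
    have h2 := hPne x hx
    have h3 : qTheta q x = (1 - x) * P x := rfl
    have h4 := hgK x
    rw [h3]
    simp only [hK] at h4
    field_simp at h4 ⊢
    linear_combination -h4
  have hne1 : ∀ x : ℂ, ‖x‖ ≠ 1 → x ≠ 1 := fun x hx h => hx (by simp [h])
  -- Comparison of the values at `x` and `y`: since `D y = 0`, the constant is `y / (1 - y) ^ 2 +
  -- lambertSym q y`.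
  have hconst := eq_of_differentiableOn_nomeAnnulus_of_periodic hq hq1
    (g := fun x => g x + lambertSym q x) (hg.add (differentiableOn_lambertSym hq hq1)) ?_ hx hy
  · simp only [hgeq x hx hx1, hgeq y hy hy1, hDy] at hconst
    have h5 : C * (D x / qTheta q x ^ 2) = -(y * qProd q 1 ^ 4 * (qTheta q (x * y) *
        qTheta q (x * y⁻¹))) / (qTheta q x ^ 2 * qTheta q y ^ 2) := by
      have := qTheta_ne_zero hq hq1 hx hx1
      simp only [hC, hD]
      field_simp
    rw [← h5]
    linear_combination hconst
  · intro x hx hx'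
    have hx0 : x ≠ 0 := norm_pos_iff.1 (zero_lt_one.trans hx)
    have hxU : x ∈ nomeAnnulus q := ⟨hq1.trans hx, hx'⟩
    have hqx := norm_mul_lt_one_of_mem_nomeAnnulus hq hxU
    have hqxU : q * x ∈ nomeAnnulus q := by
      refine ⟨?_, hqx.trans ((one_lt_inv₀ hq).2 hq1)⟩
      rw [norm_mul]
      exact lt_mul_of_one_lt_right hq hx
    have h6 : D (q * x) / qTheta q (q * x) ^ 2 = D x / qTheta q x ^ 2 := by
      rw [hDmul x hx0, qTheta_mul hq0 hq1 hx0, mul_pow, neg_sq, inv_pow,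
        mul_comm (x ^ 2)⁻¹, mul_div_mul_right _ _ (inv_ne_zero (pow_ne_zero 2 hx0))]
    simp only [hgeq x hxU (hne1 x hx.ne'), hgeq _ hqxU (hne1 _ hqx.ne), h6]
    linear_combination lambertSym_mul hq hq1 hx hx'

/-! ### Divisor sums and the Gauss sum -/

theorem norm_kronecker8_le (m : ℕ) : ‖(kronecker8 m : ℂ)‖ ≤ 1 := by
  unfold kronecker8
  split_ifs <;> simp

/-- The double series `∑ d c(d) qᵐᵈ` converges absolutely; it is summed by `n = m d` on one side and
as geometric series in `m` on the other. -/
theorem hasSum_divisors_mul_pow {q : ℂ} (hq1 : ‖q‖ < 1) {c : ℕ → ℂ} (hc : ∀ d, ‖c d‖ ≤ 1) :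
    HasSum (fun n : ℕ+ => (∑ d ∈ (n : ℕ).divisors, (d : ℂ) * c d) * q ^ (n : ℕ))
      (∑' d : ℕ, c d * (d * q ^ d / (1 - q ^ d))) := by
  set F : ℕ+ × ℕ+ → ℂ := fun p => p.2 * c p.2 * q ^ (p.1 * p.2 : ℕ) with hF
  have hFs : Summable F := by
    refine Summable.of_norm_bounded (summable_prod_mul_pow 1 hq1).norm fun p => ?_
    simp only [hF, norm_mul, pow_one]
    have := hc p.2
    calc _ ≤ ‖((p.2 : ℕ) : ℂ)‖ * 1 * ‖q ^ (p.1 * p.2 : ℕ)‖ := by gcongr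
      _ = _ := by rw [mul_one]
  have h1 : HasSum (fun n : ℕ+ => (∑ d ∈ (n : ℕ).divisors, (d : ℂ) * c d) * q ^ (n : ℕ))
      (∑' p, F p) := by
    refine (sigmaAntidiagonalEquivProd.hasSum_iff.2 hFs.hasSum).sigma fun n => ?_
    have h := hasSum_fintype fun x : (n : ℕ).divisorsAntidiagonal =>
      F (sigmaAntidiagonalEquivProd ⟨n, x⟩)
    convert! h using 1
    simp only [hF, sigmaAntidiagonalEquivProd, divisorsAntidiagonalFactors,
      Equiv.coe_fn_mk, PNat.mk_coe, Finset.univ_eq_attach]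
    rw [(n : ℕ).divisorsAntidiagonal.sum_attach
      (fun x : ℕ × ℕ => (x.2 : ℂ) * c x.2 * q ^ (x.1 * x.2)), Finset.sum_mul,
      Nat.sum_divisorsAntidiagonal' fun x y => (y : ℂ) * c y * q ^ (x * y)]
    refine Finset.sum_congr rfl fun d hd => ?_
    rw [Nat.div_mul_cancel (Nat.dvd_of_mem_divisors hd)]
  have h2 : ∑' p, F p = ∑' d : ℕ, c d * (d * q ^ d / (1 - q ^ d)) := by
    have h3 : ∀ d : ℕ+, ∑' m : ℕ+, F (m, d) = c d * (d * q ^ (d : ℕ) / (1 - q ^ (d : ℕ))) := by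
      intro d
      have hd : ‖q ^ (d : ℕ)‖ < 1 := by
        rw [norm_pow]; exact pow_lt_one₀ (norm_nonneg _) hq1 d.ne_zero
      have h4 : ∑' m : ℕ+, (q ^ (d : ℕ)) ^ (m : ℕ) = q ^ (d : ℕ) / (1 - q ^ (d : ℕ)) := by
        rw [tsum_pnat_eq_tsum_succ (f := fun m => (q ^ (d : ℕ)) ^ m)]
        simp only [pow_succ]
        rw [tsum_mul_right, tsum_geometric_of_norm_lt_one hd]
        field_simp
      simp only [hF]
      rw [tsum_congr (g := fun m : ℕ+ => (d * c d) * (q ^ (d : ℕ)) ^ (m : ℕ))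
        (fun m => by rw [← pow_mul, mul_comm (d : ℕ)]), tsum_mul_left, h4]
      ring
    have h5 : ∑' d : ℕ, c d * (d * q ^ d / (1 - q ^ d)) =
        ∑' d : ℕ+, c d * (d * q ^ (d : ℕ) / (1 - q ^ (d : ℕ))) := by
      rw [← Function.Injective.tsum_eq PNat.coe_injective
        (f := fun d : ℕ => c d * (d * q ^ d / (1 - q ^ d)))]
      intro d hd
      rcases Nat.eq_zero_or_pos d with rfl | h
      · simp at hd
      · exact ⟨⟨d, h⟩, rfl⟩
    rw [h5, ← tsum_congr h3, ← (Equiv.prodComm ℕ+ ℕ+).tsum_eq F]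
    exact ((Equiv.prodComm ℕ+ ℕ+).summable_iff.2 hFs).tsum_prod
  rwa [← h2]

/-- This is the Gauss sum of the even character `χ₈`, with `ζ - ζ ^ 3` a square root of `2`. Both
sides depend only on `d` modulo `8`, which leaves eight cases. -/
theorem kronecker8_gauss_sum {ζ : ℂ} (hζ : ζ ^ 4 = -1) (d : ℕ) :
    ζ ^ d + ζ⁻¹ ^ d - ((ζ ^ 3) ^ d + (ζ ^ 3)⁻¹ ^ d) = 2 * (ζ - ζ ^ 3) * kronecker8 d := by
  have h1 : ζ⁻¹ = ζ ^ 7 := by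
    refine (eq_inv_of_mul_eq_one_left ?_).symm
    linear_combination (ζ ^ 4 - 1) * hζ
  have h3 : (ζ ^ 3)⁻¹ = ζ ^ 5 := by
    refine (eq_inv_of_mul_eq_one_left ?_).symm
    linear_combination (ζ ^ 4 - 1) * hζ
  have h8 : ∀ k : ℕ, (ζ ^ k) ^ d = (ζ ^ k) ^ (d % 8) := fun k => by
    conv_lhs => rw [← Nat.div_add_mod d 8]
    have : (ζ ^ k) ^ 8 = 1 := by
      rw [← pow_mul, mul_comm, pow_mul, show ζ ^ 8 = (ζ ^ 4) ^ 2 by ring, hζ]; simp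
    rw [pow_add, pow_mul, this, one_pow, one_mul]
  have h81 := h8 1
  rw [pow_one] at h81
  rw [h1, h3, h8 7, h8 3, h8 5, h81, kronecker8]
  have h4 : ζ ^ 5 = -ζ := by linear_combination ζ * hζ
  have h5 : ζ ^ 7 = -ζ ^ 3 := by linear_combination ζ ^ 3 * hζ
  have hlt : d % 8 < 8 := Nat.mod_lt _ (by norm_num)
  rw [h4, h5]
  generalize d % 8 = r at hlt
  have e9 : ζ ^ 9 = ζ := by linear_combination (ζ ^ 5 - ζ) * hζ
  have e15 : ζ ^ 15 = -ζ ^ 3 := by linear_combination (ζ ^ 11 - ζ ^ 7 + ζ ^ 3) * hζ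
  have e21 : ζ ^ 21 = -ζ := by
    linear_combination (ζ ^ 17 - ζ ^ 13 + ζ ^ 9 - ζ ^ 5 + ζ) * hζ
  interval_cases r <;> ring_nf <;> norm_num <;> simp only [h4, h5, e9, e15, e21] <;>
    ring

theorem lambertSym_sub_lambertSym {q ζ : ℂ} (hq : 0 < ‖q‖) (hq1 : ‖q‖ < 1) (hζ : ζ ^ 4 = -1)
    (h1 : ζ ∈ nomeAnnulus q) (h3 : ζ ^ 3 ∈ nomeAnnulus q) :
    lambertSym q ζ - lambertSym q (ζ ^ 3) =
      2 * (ζ - ζ ^ 3) * ∑' d : ℕ, kronecker8 d * (d * q ^ d / (1 - q ^ d)) := by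
  have s : ∀ x ∈ nomeAnnulus q, Summable fun d : ℕ => d * q ^ d / (1 - q ^ d) * x ^ d :=
    fun x hx => summable_lambertSeries hq1 (norm_mul_lt_one_of_mem_nomeAnnulus hq hx)
  have s1 := s _ h1
  have s2 := s _ (inv_mem_nomeAnnulus hq h1)
  have s3 := s _ h3
  have s4 := s _ (inv_mem_nomeAnnulus hq h3)
  simp only [lambertSym, lambertSeries]
  rw [← s1.tsum_add s2, ← s3.tsum_add s4, ← (s1.add s2).tsum_sub (s3.add s4), ← tsum_mul_left]
  refine tsum_congr fun d => ?_
  linear_combination (d * q ^ d / (1 - q ^ d)) * kronecker8_gauss_sum hζ d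

/-! ### Specialisation at eighth roots of unity -/

theorem qProd_quotient_eq_one_sub_tsum {q : ℂ} (hq : 0 < ‖q‖) (hq1 : ‖q‖ < 1) :
    qProd q 1 ^ 2 * qProd (q ^ 2) 1 * qProd (q ^ 4) 1 ^ 3 / qProd (q ^ 8) 1 ^ 2 =
      1 - 2 * ∑' d : ℕ, kronecker8 d * (d * q ^ d / (1 - q ^ d)) := by
  obtain ⟨ζ, hζ⟩ : ∃ ζ : ℂ, ζ ^ 4 = -1 := IsAlgClosed.exists_pow_nat_eq _ (by norm_num)
  have hζ0 : ζ ≠ 0 := by rintro rfl; norm_num at hζ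
  have hn : ‖ζ‖ = 1 := by
    have : ‖ζ‖ ^ 4 = 1 := by rw [← norm_pow, hζ]; simp
    exact (pow_eq_one_iff_of_nonneg (norm_nonneg _) (by norm_num)).1 this
  have hU : ∀ x : ℂ, ‖x‖ = 1 → x ∈ nomeAnnulus q :=
    fun x hx => mem_nomeAnnulus_of_norm_eq_one hq hq1 hx
  have hU1 := hU ζ hn
  have hU3 := hU (ζ ^ 3) (by simp [hn])
  have h11 : ζ ≠ 1 := by rintro rfl; norm_num at hζ
  have h31 : ζ ^ 3 ≠ 1 := fun h => by
    have : ζ = -1 := by linear_combination hζ - ζ * h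
    rw [this] at h; norm_num at h
  have main := weierstrass_sub_weierstrass_eq_qTheta hq hq1 hU1 h11 hU3 h31
  have hL := lambertSym_sub_lambertSym hq hq1 hζ hU1 hU3
  set S := ∑' d : ℕ, kronecker8 d * (d * q ^ d / (1 - q ^ d))
  have hs : (ζ - ζ ^ 3) ^ 2 = 2 := by linear_combination (-2 + ζ ^ 2) * hζ
  have hs0 : ζ - ζ ^ 3 ≠ 0 := by intro h; rw [h] at hs; norm_num at hs
  have d1 : 1 - ζ ≠ 0 := sub_ne_zero.2 h11.symm
  have d3 : 1 - ζ ^ 3 ≠ 0 := sub_ne_zero.2 h31.symm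
  -- As `ζ ^ 4 = -1`, the base equals `-(ζ + ζ ^ 3)`.
  have hd : ((1 - ζ) * (1 - ζ ^ 3)) ^ 2 = -2 := by
    linear_combination (1 + ζ ^ 4 - 2 * ζ - 2 * ζ ^ 3 + ζ ^ 2 + 2) * hζ
  -- The rational parts supply the constant term `1` of the final series, once `-(ζ - ζ ^ 3)` is
  -- divided out.
  have hc : ζ / (1 - ζ) ^ 2 - ζ ^ 3 / (1 - ζ ^ 3) ^ 2 = -(ζ - ζ ^ 3) := by
    rw [div_sub_div _ _ (pow_ne_zero 2 d1) (pow_ne_zero 2 d3), ← mul_pow, hd]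
    linear_combination (-(ζ - ζ ^ 3) / 2) * -hζ
  have i1 : ζ⁻¹ = -ζ ^ 3 := by
    refine (eq_inv_of_mul_eq_one_left ?_).symm
    linear_combination -hζ
  have i3 : (ζ ^ 3)⁻¹ = -ζ := by
    refine (eq_inv_of_mul_eq_one_left ?_).symm
    linear_combination -hζ
  have i2 : (-ζ ^ 2)⁻¹ = ζ ^ 2 := by
    refine (eq_inv_of_mul_eq_one_left ?_).symm
    linear_combination -hζ
  have hpow : ∀ k : ℕ, k ≠ 0 → ‖q ^ k‖ < 1 := fun k hk => by
    rw [norm_pow]; exact pow_lt_one₀ (norm_nonneg _) hq1 hk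
  have hE : ∀ k : ℕ, k ≠ 0 → qProd (q ^ k) 1 ≠ 0 := fun k hk =>
    qProd_ne_zero (hpow k hk) (by simpa using hpow k hk)
  have p1 := qProd_mul_qProd_neg hq1 1
  have p2 := qProd_mul_qProd_neg (hpow 2 (by norm_num)) 1
  have p4 := qProd_mul_qProd_neg (hpow 4 (by norm_num)) 1
  have p5 := qProd_mul_qProd_neg hq1 (ζ ^ 2)
  have p6 := qProd_mul_qProd_neg hq1 ζ
  have p7 := qProd_mul_qProd_neg hq1 (ζ ^ 3)
  have p8 := qProd_mul_qProd_neg (hpow 2 (by norm_num)) (ζ ^ 2)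
  rw [show (ζ ^ 3) ^ 2 = -ζ ^ 2 by linear_combination ζ ^ 2 * hζ] at p7
  rw [show (ζ ^ 2) ^ 2 = -1 by linear_combination hζ] at p5 p8
  simp only [one_pow, ← pow_mul, Nat.reduceMul] at p1 p2 p4 p5 p6 p7 p8
  -- The theta arguments `x y` and `x y⁻¹` become `-1` and `-ζ ^ 2`.
  rw [show ζ * ζ ^ 3 = -1 by linear_combination hζ,
    show ζ * (ζ ^ 3)⁻¹ = -ζ ^ 2 by rw [i3]; ring] at main
  simp only [qTheta, i1, i2, i3, show (-1 : ℂ)⁻¹ = -1 by norm_num] at main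
  have e1 := hE 1 one_ne_zero
  rw [pow_one] at e1
  have e2 := hE 2 two_ne_zero
  have e4 := hE 4 four_ne_zero
  have e8 := hE 8 (by norm_num)
  have hb : qProd q (-1) = qProd (q ^ 2) 1 / qProd q 1 := by
    rw [eq_div_iff e1]; linear_combination p1
  have hc' : qProd q (-ζ ^ 2) * qProd q (ζ ^ 2) = qProd (q ^ 4) 1 / qProd (q ^ 2) 1 := by
    rw [eq_div_iff e2]; linear_combination p2 + qProd (q ^ 2) 1 * p5
  have hd' : qProd q ζ * qProd q (-ζ ^ 3) * (qProd q (ζ ^ 3) * qProd q (-ζ)) =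
      qProd (q ^ 8) 1 / qProd (q ^ 4) 1 := by
    rw [eq_div_iff e4, ← p4, ← p8, ← p6, ← p7]; ring
  have hden : ((1 - ζ) * (qProd q ζ * qProd q (-ζ ^ 3))) ^ 2 *
      ((1 - ζ ^ 3) * (qProd q (ζ ^ 3) * qProd q (-ζ))) ^ 2 =
      -2 * (qProd (q ^ 8) 1 / qProd (q ^ 4) 1) ^ 2 := by
    rw [← hd', ← hd]; ring
  rw [hc', hb, hden] at main
  have hfin : (ζ - ζ ^ 3) * (1 - 2 * S) = (ζ - ζ ^ 3) * (qProd q 1 ^ 2 * qProd (q ^ 2) 1 *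
      qProd (q ^ 4) 1 ^ 3 / qProd (q ^ 8) 1 ^ 2) := by
    have h : (ζ - ζ ^ 3) * (1 - 2 * S) = -(ζ / (1 - ζ) ^ 2 + lambertSym q ζ -
        (ζ ^ 3 / (1 - ζ ^ 3) ^ 2 + lambertSym q (ζ ^ 3))) := by
      linear_combination hL + hc
    rw [h, main]
    field_simp
    -- What remains is the scalar identity `ζ ^ 3 * (1 + ζ ^ 2) = -(ζ - ζ ^ 3)`.
    linear_combination -2 * hζ
  exact (mul_left_cancel₀ hs0 hfin).symm

/-! ### Passage to the eta function -/

theorem eta_natCast_mul (k : ℕ) (z : ℂ) :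
    ModularForm.eta (k * z) = Complex.exp (2 * Real.pi * I * z / 24) ^ k *
      qProd (Complex.exp (2 * Real.pi * I * z) ^ k) 1 := by
  rw [ModularForm.eta, qProd]
  congr 1
  · rw [Function.Periodic.qParam, ← Complex.exp_nat_mul]
    congr 1
    push_cast
    ring
  · refine tprod_congr fun n => ?_
    rw [ModularForm.eta_q_eq_pow, mul_one, ← Complex.exp_nat_mul _ k]
    congr 3
    ring

theorem mainTheorem7 (τ : UpperHalfPlane) :
    Summable (fun n : ℕ+ =>
      (∑ d ∈ (n : ℕ).divisors, (d : ℂ) * (kronecker8 d : ℂ)) *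
        Complex.exp (2 * (Real.pi : ℂ) * Complex.I * (τ : ℂ)) ^ (n : ℕ)) ∧
    ModularForm.eta (τ : ℂ) ^ 2 * ModularForm.eta (2 * (τ : ℂ)) *
        ModularForm.eta (4 * (τ : ℂ)) ^ 3 / ModularForm.eta (8 * (τ : ℂ)) ^ 2 =
      1 - 2 * ∑' n : ℕ+,
        (∑ d ∈ (n : ℕ).divisors, (d : ℂ) * (kronecker8 d : ℂ)) *
          Complex.exp (2 * (Real.pi : ℂ) * Complex.I * (τ : ℂ)) ^ (n : ℕ) := by
  have hq1 : ‖Complex.exp (2 * Real.pi * I * τ)‖ < 1 := UpperHalfPlane.norm_exp_two_pi_I_lt_one τ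
  have hsum := hasSum_divisors_mul_pow hq1 norm_kronecker8_le
  refine ⟨hsum.summable, ?_⟩
  rw [hsum.tsum_eq, ← qProd_quotient_eq_one_sub_tsum (norm_pos_iff.2 (Complex.exp_ne_zero _)) hq1]
  have h1 := eta_natCast_mul 1 τ
  have h2 := eta_natCast_mul 2 τ
  have h4 := eta_natCast_mul 4 τ
  have h8 := eta_natCast_mul 8 τ
  simp only [Nat.cast_one, one_mul, pow_one, Nat.cast_ofNat] at h1 h2 h4 h8
  rw [h1, h2, h4, h8]
  have h0 := Complex.exp_ne_zero (2 * Real.pi * I * τ / 24)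
  generalize Complex.exp (2 * Real.pi * I * τ / 24) = Q at h0
  generalize Complex.exp (2 * Real.pi * I * τ) = q
  -- The prefactors of eta cancel because `2·1 + 1·2 + 3·4 = 16 = 2·8`.
  rw [← mul_div_mul_left _ (qProd (q ^ 8) 1 ^ 2) (pow_ne_zero 16 h0)]
  congr 1 <;> ring
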